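/- Let $M$ be a smooth manifold of dimension $n$, $A^k(M)=\Gamma(\wedge^kTM)$, $\mathcal A(M)=\bigoplus_k A^k(M)$ (with $A^{-1}(M)=0$), and for $X\in A^k(M)$, $f\in C^\infty(M)$ let $[X,f]\in A^{k-1}(M)$ be the Schouten–Nijenhuis bracket, i.e. $[X_1\wedge\cdots\wedge X_k,f]=\sum_j(-1)^{k-j}(X_jf)\,X_1\wedge\cdots\widehat{X_j}\cdots\wedge X_k$. A *higher connection* on $M$ is a map $\nabla:\mathcal A(M)\times\mathcal A(M)\to\mathcal A(M)$, additive in both arguments and $C^\infty(M)$-linear in the first, with $\nabla_XY\in A^{k+l-1}(M)$, $\nabla_Xf=[X,f]$, $\nabla_X(fY)=[X,f]\wedge Y+f\nabla_XY$ and $\nabla_fX=0$. It is *induced* if $\nabla_{X\wedge Y}Z=X\wedge\nabla_YZ+(-1)^{kl}Y\wedge\nabla_XZ$ and $\nabla_X(Y\wedge Z)=(\nabla_XY)\wedge Z+(-1)^{(k-1)l}Y\wedge\nabla_XZ$ for $X\in A^k(M)$, $Y\in A^l(M)$, $Z\in\mathcal A(M)$; every affine connection $\widetilde\nabla$ on $TM$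 extends uniquely to an induced higher connection, also denoted $\widetilde\nabla$. The *data* of a higher connection $\nabla$ is the unique pair $(\widetilde\nabla,\{F^{k,l}\})$ of an affine connection $\widetilde\nabla$ on $TM$ and sections $F^{k,l}$ of $\wedge^{k+l-1}TM\otimes\wedge^kT^*M\otimes\wedge^lT^*M$ ($k,l>0$, $k+l-1\le n$; $F^{k,l}:=0$ for other $k,l$) with $F^{1,1}=0$ and $\nabla_XY=\widetilde\nabla_XY+F^{k,l}(X,Y)$ for all $X\in A^k(M)$, $Y\in A^l(M)$. For a higher connection $\nabla$, $X\in A^k(M)$ with $k>0$, $\omega\in\Omega^t(M)$ with $t-k+1\ge0$, and $Y\in A^{t-k+1}(M)$, put $$(\nabla_X\omega)(Y)=(-1)^{(k-1)(t-1)}L_Xi_Y\omega-\omega(\nabla_XY),$$ where $(i_Y\omega)(Z)=\omega(Y\wedge Z)$ and $L_X=d\,i_X-(-1)^ki_X\,d$. Let $\eta$ be a smooth fiberwise bilinear form on $\wedge^\bullet TM$ that is associative, $\eta(x\wedge y,z)=\eta(x,y\wedge z)$, and let $\omega^{(t)}\in\Omega^t(M)$, $0\le t\le n$, be the associated forms,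 determined by $\eta(x,y)=\omega^{(k+l)}(x\wedge y)$ for $x\in\wedge^kT_pM$, $y\in\wedge^lT_pM$, $k+l\le n$. For $X\in A^k(M)$, $Y\in A^l(M)$, $Z\in A^m(M)$ with $k>0$ and $k+l+m\le n+1$ put $(\nabla_X\eta)(Y,Z)=(\nabla_X\omega^{(k+l+m-1)})(Y\wedge Z)$. One writes $\nabla\eta\equiv0$ if $(\nabla_X\eta)(Y,Z)=0$ for all such $X,Y,Z$ with $l+m>0$. **Proposition.** Let $\eta$ be as above with associated forms $\{\omega^{(t)}\}$, and let $\nabla$ be a higher connection on $M$ with data $(\widetilde\nabla,\{F^{k,l}\})$. Then $\nabla\eta\equiv0$ if and only if $$(\widetilde\nabla_X\omega^{(t)})(Y)=\omega^{(t)}(F^{k,l}(X,Y))$$ for all $X\in A^k(M)$, $Y\in A^l(M)$ with $k,l>0$ and $t=k+l-1\le n$. -/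

import Mathlib

open scoped Manifold ContDiff

noncomputable section

namespace HigherConnections

/-- The `ℝ`-linear differential at `q` of the chart of `M` centred at `p`. -/
def chartDeriv (n : ℕ) (M : Type*) [TopologicalSpace M]
    [ChartedSpace (EuclideanSpace ℝ (Fin n)) M] (p q : M) :
    TangentSpace (𝓡 n) q →L[ℝ] EuclideanSpace ℝ (Fin n) :=
  mfderiv (𝓡 n) 𝓘(ℝ, EuclideanSpace ℝ (Fin n)) (extChartAt (𝓡 n) p) q

/-- The `ℝ`-linear differential at `y` of the inverse of the chart of `M` centred at `p`. -/
def chartSymmDeriv (n : ℕ) (M : Type*) [TopologicalSpace M]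
    [ChartedSpace (EuclideanSpace ℝ (Fin n)) M] (p : M) (y : EuclideanSpace ℝ (Fin n)) :
    EuclideanSpace ℝ (Fin n) →L[ℝ] TangentSpace (𝓡 n) ((extChartAt (𝓡 n) p).symm y) :=
  mfderiv 𝓘(ℝ, EuclideanSpace ℝ (Fin n)) (𝓡 n) (extChartAt (𝓡 n) p).symm y

/-- A section `X` of the full exterior bundle `⋀ TM` is smooth if in each chart all of its
coordinates (with respect to the constant vector space `⋀ ℝⁿ`) are smooth functions. -/
def IsSmoothMV (n : ℕ) (M : Type*) [TopologicalSpace M]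
    [ChartedSpace (EuclideanSpace ℝ (Fin n)) M]
    (X : ∀ p : M, ExteriorAlgebra ℝ (TangentSpace (𝓡 n) p)) : Prop :=
  ∀ (p : M) (φ : Module.Dual ℝ (ExteriorAlgebra ℝ (EuclideanSpace ℝ (Fin n)))),
    ContMDiffOn (𝓡 n) 𝓘(ℝ) ∞
      (fun q ↦ φ (ExteriorAlgebra.map (chartDeriv n M p q).toLinearMap (X q)))
      (extChartAt (𝓡 n) p).source

/-- The algebra `𝒜(M)` of (smooth) multivector fields, i.e. of smooth sections of `⋀ TM`, with the
pointwise exterior product. -/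
def MVField (n : ℕ) (M : Type*) [TopologicalSpace M]
    [ChartedSpace (EuclideanSpace ℝ (Fin n)) M] :
    Subalgebra ℝ (∀ p : M, ExteriorAlgebra ℝ (TangentSpace (𝓡 n) p)) where
  carrier := {X | IsSmoothMV n M X}
  add_mem' := by
    intro X Y hX hY p φ
    simp only [Pi.add_apply, map_add]
    exact (hX p φ).add (hY p φ)
  mul_mem' := by
    intro X Y hX hY p φ
    let b := (EuclideanSpace.basisFun (Fin n) ℝ).toBasis.ExteriorAlgebra
    have key : ∀ x y : ExteriorAlgebra ℝ (EuclideanSpace ℝ (Fin n)),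
        φ (x * y) = ∑ s, ∑ t, b.coord s x * b.coord t y * φ (b s * b t) := by
      intro x y
      conv_lhs => rw [← b.sum_repr x, ← b.sum_repr y]
      rw [Finset.sum_mul_sum]
      simp only [smul_mul_assoc, mul_smul_comm, map_sum, map_smul, smul_eq_mul,
        Module.Basis.coord_apply]
      refine Finset.sum_congr rfl fun s _ ↦ Finset.sum_congr rfl fun t _ ↦ ?_
      ring
    have e : (fun q ↦ φ (ExteriorAlgebra.map (chartDeriv n M p q).toLinearMap ((X * Y) q))) =
        fun q ↦ ∑ s, ∑ t,
          b.coord s (ExteriorAlgebra.map (chartDeriv n M p q).toLinearMap (X q)) *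
          b.coord t (ExteriorAlgebra.map (chartDeriv n M p q).toLinearMap (Y q)) *
          φ (b s * b t) := by
      funext q
      rw [Pi.mul_apply, map_mul, key]
    rw [e]
    refine contMDiffOn_finsetSum fun s _ ↦ contMDiffOn_finsetSum fun t _ ↦ ?_
    exact ((hX p (b.coord s)).mul (hY p (b.coord t))).mul contMDiffOn_const
  algebraMap_mem' := by
    intro r p φ
    simpa [Algebra.algebraMap_eq_smul_one] using contMDiffOn_const

/-- `A^k(M)`: the `k`-vector fields. -/
def KVField (n : ℕ) (M : Type*) [TopologicalSpace M]
    [ChartedSpace (EuclideanSpace ℝ (Fin n)) M] (k : ℕ) : Submodule ℝ (MVField n M) where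
  carrier := {X | ∀ p, X.1 p ∈ ⋀[ℝ]^k (TangentSpace (𝓡 n) p)}
  add_mem' := fun hX hY p ↦ Submodule.add_mem _ (hX p) (hY p)
  zero_mem' := fun _ ↦ Submodule.zero_mem _
  smul_mem' := fun c _ hX p ↦ Submodule.smul_mem _ c (hX p)

/-- A smooth function regarded as an element of `A^0(M) ⊆ 𝒜(M)`.  The product of a function `f` with
a multivector field `X` is `ofFun f * X`. -/
def ofFun {n : ℕ} {M : Type*} [TopologicalSpace M]
    [ChartedSpace (EuclideanSpace ℝ (Fin n)) M] (f : C^∞⟮𝓡 n, M; ℝ⟯) : MVField n M :=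
  ⟨fun p ↦ algebraMap ℝ _ (f p), by
    intro p φ
    simp only [AlgHom.commutes]
    simp only [Algebra.algebraMap_eq_smul_one, map_smul, smul_eq_mul]
    exact (f.contMDiff.contMDiffOn).mul contMDiffOn_const⟩

/-- The Schouten–Nijenhuis bracket `[X, f]` of a multivector field with a function: the
contraction of `X` with `df` from the right.  For `X = X₁ ∧ ⋯ ∧ X_k` it is
`∑ⱼ (-1)^(k-j) (Xⱼ f) X₁ ∧ ⋯ ∧ X̂ⱼ ∧ ⋯ ∧ X_k`, and it vanishes for `k = 0`. -/
def bracketFun {n : ℕ} {M : Type*} [TopologicalSpace M]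
    [ChartedSpace (EuclideanSpace ℝ (Fin n)) M] (X : MVField n M) (f : C^∞⟮𝓡 n, M; ℝ⟯) (p : M) :
    ExteriorAlgebra ℝ (TangentSpace (𝓡 n) p) :=
  CliffordAlgebra.contractRight (X.1 p) (mvfderiv (𝓡 n) f p).toLinearMap

/-- A higher affine connection on `M`.  In `map_mem`, `A^{-1}(M) = 0` for `k = l = 0` is covered
by `fun_left`. -/
structure HigherConnection (n : ℕ) (M : Type*) [TopologicalSpace M]
    [ChartedSpace (EuclideanSpace ℝ (Fin n)) M] where
  toFun : MVField n M → MVField n M → MVField n M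
  map_mem : ∀ (k l : ℕ), ∀ X ∈ KVField n M k, ∀ Y ∈ KVField n M l,
    toFun X Y ∈ KVField n M (k + l - 1)
  smul_add_left : ∀ (f : C^∞⟮𝓡 n, M; ℝ⟯) (X X' Y : MVField n M),
    toFun (ofFun f * X + X') Y = ofFun f * toFun X Y + toFun X' Y
  add_right : ∀ X Y Y' : MVField n M, toFun X (Y + Y') = toFun X Y + toFun X Y'
  fun_right : ∀ k, ∀ X ∈ KVField n M k, ∀ f : C^∞⟮𝓡 n, M; ℝ⟯,
    ∀ p, (toFun X (ofFun f)).1 p = bracketFun X f p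
  leibniz : ∀ k, ∀ X ∈ KVField n M k, ∀ (f : C^∞⟮𝓡 n, M; ℝ⟯) (Y : MVField n M),
    ∀ p, (toFun X (ofFun f * Y)).1 p = bracketFun X f p * Y.1 p + f p • (toFun X Y).1 p
  fun_left : ∀ (f : C^∞⟮𝓡 n, M; ℝ⟯) (X : MVField n M), toFun (ofFun f) X = 0

/-- A higher connection is induced if it is a derivation in both arguments. -/
def HigherConnection.IsInduced {n : ℕ} {M : Type*} [TopologicalSpace M]
    [ChartedSpace (EuclideanSpace ℝ (Fin n)) M] (C : HigherConnection n M) : Prop :=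
  ∀ k l : ℕ, ∀ X ∈ KVField n M k, ∀ Y ∈ KVField n M l, ∀ Z : MVField n M,
    C.toFun (X * Y) Z = X * C.toFun Y Z + (-1 : ℝ) ^ (k * l) • (Y * C.toFun X Z) ∧
    C.toFun X (Y * Z) = C.toFun X Y * Z + (-1 : ℝ) ^ (((k : ℤ) - 1) * l) • (Y * C.toFun X Z)

/-- `C` is the induced higher connection that extends the affine connection `D` on `TM`: it is
induced, and `C_V W = D_V W` for all vector fields `V`, `W`.
Mathlib writes `D W p (V p)` for `(D_V W)(p)`. -/
def HigherConnection.IsInducedBy {n : ℕ} {M : Type*} [TopologicalSpace M]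
    [ChartedSpace (EuclideanSpace ℝ (Fin n)) M] [IsManifold (𝓡 n) ∞ M] (C : HigherConnection n M)
    (D : CovariantDerivative (𝓡 n) (EuclideanSpace ℝ (Fin n))
      (fun p : M ↦ TangentSpace (𝓡 n) p)) : Prop :=
  C.IsInduced ∧
    ∀ (V W : ∀ p : M, TangentSpace (𝓡 n) p) (X Y : MVField n M),
      (∀ p, X.1 p = ExteriorAlgebra.ι ℝ (V p)) → (∀ p, Y.1 p = ExteriorAlgebra.ι ℝ (W p)) →
      ∀ p, (C.toFun X Y).1 p = ExteriorAlgebra.ι ℝ (D W p (V p))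

/-- A family of twist fields: sections `F^{k,l}` of `⋀^{k+l-1} TM ⊗ ⋀^k T*M ⊗ ⋀^l T*M` with
`F^{1,1} = 0`, for `k, l > 0` and `k + l - 1 ≤ n`; outside this range `F^{k,l} = 0` by
convention.  Such a section is a family of bilinear maps `⋀^k T_pM × ⋀^l T_pM → ⋀^{k+l-1} T_pM`
that sends smooth multivector fields to smooth multivector fields. -/
structure TwistFields (n : ℕ) (M : Type*) [TopologicalSpace M]
    [ChartedSpace (EuclideanSpace ℝ (Fin n)) M] where
  toFun : ∀ (k l : ℕ) (p : M), ⋀[ℝ]^k (TangentSpace (𝓡 n) p) →ₗ[ℝ]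
    ⋀[ℝ]^l (TangentSpace (𝓡 n) p) →ₗ[ℝ] ⋀[ℝ]^(k + l - 1) (TangentSpace (𝓡 n) p)
  smooth : ∀ (k l : ℕ) (X Y : MVField n M) (hX : X ∈ KVField n M k) (hY : Y ∈ KVField n M l),
    IsSmoothMV n M (fun p ↦ (toFun k l p ⟨X.1 p, hX p⟩ ⟨Y.1 p, hY p⟩ :
      ExteriorAlgebra ℝ (TangentSpace (𝓡 n) p)))
  one_one : ∀ p, toFun 1 1 p = 0
  eq_zero : ∀ (k l : ℕ) (p : M), k = 0 ∨ l = 0 ∨ n < k + l - 1 → toFun k l p = 0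

/-- The multivector field `F^{k,l}(X, Y)`. -/
def TwistFields.app {n : ℕ} {M : Type*} [TopologicalSpace M]
    [ChartedSpace (EuclideanSpace ℝ (Fin n)) M] (F : TwistFields n M) {k l : ℕ}
    (X : KVField n M k) (Y : KVField n M l) : MVField n M :=
  ⟨fun p ↦ F.toFun k l p ⟨X.1.1 p, X.2 p⟩ ⟨Y.1.1 p, Y.2 p⟩, F.smooth k l X.1 Y.1 X.2 Y.2⟩

/-- `(D, F)` is the pair associated with the higher connection `C`: `C_X Y = D_X Y + F^{k,l}(X, Y)`
for all `X ∈ A^k(M)`, `Y ∈ A^l(M)`.  Here `Dt` is the induced higher connection of `D`. -/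
def HigherConnection.HasData {n : ℕ} {M : Type*} [TopologicalSpace M]
    [ChartedSpace (EuclideanSpace ℝ (Fin n)) M] [IsManifold (𝓡 n) ∞ M] (C : HigherConnection n M)
    (D : CovariantDerivative (𝓡 n) (EuclideanSpace ℝ (Fin n))
      (fun p : M ↦ TangentSpace (𝓡 n) p))
    (Dt : HigherConnection n M) (F : TwistFields n M) : Prop :=
  CovariantDerivative.ContMDiffCovariantDerivative D ∞ ∧ Dt.IsInducedBy D ∧
    ∀ (k l : ℕ) (X : KVField n M k) (Y : KVField n M l),
      C.toFun X Y = Dt.toFun X Y + F.app X Y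

/-! ### Differential forms

A form is a section of `(⋀ TM)* ≅ ⋀ T*M`; a `t`-form `α` is evaluated on `t`-vectors by
`α (v₁ ∧ ⋯ ∧ v_t) = α (v₁, …, v_t)` and vanishes on `j`-vectors with `j ≠ t`. -/

/-- Not necessarily smooth, not necessarily homogeneous forms on `M`. -/
abbrev Form (n : ℕ) (M : Type*) [TopologicalSpace M]
    [ChartedSpace (EuclideanSpace ℝ (Fin n)) M] : Type _ :=
  ∀ p : M, Module.Dual ℝ (ExteriorAlgebra ℝ (TangentSpace (𝓡 n) p))

/-- `Ω^t(M)`: the smooth `t`-forms on `M`. -/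
def DiffForm (n : ℕ) (M : Type*) [TopologicalSpace M]
    [ChartedSpace (EuclideanSpace ℝ (Fin n)) M] (t : ℕ) : Submodule ℝ (Form n M) where
  carrier := {α | (∀ j, j ≠ t → ∀ p, ∀ x ∈ ⋀[ℝ]^j (TangentSpace (𝓡 n) p), α p x = 0) ∧
    ∀ X : MVField n M, ContMDiff (𝓡 n) 𝓘(ℝ) ∞ (fun p ↦ α p (X.1 p))}
  add_mem' := by
    rintro α β ⟨h, hs⟩ ⟨h', hs'⟩
    refine ⟨fun j hj p x hx ↦ ?_, fun X ↦ ?_⟩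
    · simp [h j hj p x hx, h' j hj p x hx]
    · exact (hs X).add (hs' X)
  zero_mem' := ⟨fun _ _ _ _ _ ↦ rfl, fun _ ↦ contMDiff_const⟩
  smul_mem' := by
    rintro c α ⟨h, hs⟩
    refine ⟨fun j hj p x hx ↦ ?_, fun X ↦ ?_⟩
    · simp [h j hj p x hx]
    · exact contMDiff_const.mul (hs X)

/-- The interior product: `(i_X α)(Y) = α (X ∧ Y)`. -/
def interior {n : ℕ} {M : Type*} [TopologicalSpace M]
    [ChartedSpace (EuclideanSpace ℝ (Fin n)) M] (X : MVField n M) (α : Form n M) : Form n M :=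
  fun p ↦ α p ∘ₗ LinearMap.mulLeft ℝ (X.1 p)

/-- An alternating form on `ℝⁿ`, as a continuous alternating form. -/
def toContinuousAlternating {n j : ℕ} (f : (EuclideanSpace ℝ (Fin n)) [⋀^Fin j]→ₗ[ℝ] ℝ) :
    (EuclideanSpace ℝ (Fin n)) [⋀^Fin j]→L[ℝ] ℝ :=
  { f with
    cont := by
      let b := (EuclideanSpace.basisFun (Fin n) ℝ).toBasis
      have key : ∀ v : Fin j → EuclideanSpace ℝ (Fin n),
          f v = ∑ r : Fin j → Fin n, (∏ i, v i (r i)) * f (fun i ↦ b (r i)) := by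
        intro v
        have hv : v = fun i ↦ ∑ a, v i a • b a := by
          funext i
          conv_lhs => rw [← b.sum_repr (v i)]
          rfl
        conv_lhs => rw [hv]
        change f.toMultilinearMap _ = _
        rw [MultilinearMap.map_sum]
        refine Finset.sum_congr rfl fun r _ ↦ ?_
        rw [MultilinearMap.map_smul_univ, smul_eq_mul]
        rfl
      change Continuous (fun v ↦ f v)
      rw [funext key]
      fun_prop }

/-- The degree `j` component of a form in the chart centred at `p`. -/
def chartForm {n : ℕ} {M : Type*} [TopologicalSpace M]
    [ChartedSpace (EuclideanSpace ℝ (Fin n)) M] (α : Form n M) (j : ℕ) (p : M)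
    (y : EuclideanSpace ℝ (Fin n)) : (EuclideanSpace ℝ (Fin n)) [⋀^Fin j]→L[ℝ] ℝ :=
  toContinuousAlternating
    (((α ((extChartAt (𝓡 n) p).symm y)).compAlternatingMap
      (ExteriorAlgebra.ιMulti ℝ j)).compLinearMap (chartSymmDeriv n M p y).toLinearMap)

/-- The exterior derivative `d : Ω(M) → Ω(M)`; at `p` it is computed in the chart centred at `p`
by Mathlib's exterior derivative on `ℝⁿ`, separately in each degree. -/
def extD {n : ℕ} {M : Type*} [TopologicalSpace M]
    [ChartedSpace (EuclideanSpace ℝ (Fin n)) M] (α : Form n M) : Form n M :=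
  fun p ↦ ExteriorAlgebra.liftAlternating fun i ↦
    match i with
    | 0 => 0
    | j + 1 => (extDeriv (chartForm α j p) (extChartAt (𝓡 n) p p)).toAlternatingMap.compLinearMap
        (chartDeriv n M p p).toLinearMap

/-- The Lie derivative of a form along `X ∈ A^k(M)`: `L_X α = d i_X α - (-1)^k i_X d α`. -/
def lieD {n : ℕ} {M : Type*} [TopologicalSpace M]
    [ChartedSpace (EuclideanSpace ℝ (Fin n)) M] {k : ℕ} (X : KVField n M k) (α : Form n M) :
    Form n M :=
  extD (interior X α) - (-1 : ℝ) ^ k • interior X (extD α)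

/-- The function `(C_X α)(Y)` for `X ∈ A^k(M)`, `α ∈ Ω^l(M)`, `Y ∈ A^{l-k+1}(M)`: for `k > 0` and
`l - k + 1 ≥ 0` it is `(-1)^((k-1)(l-1)) L_X i_Y α - α(C_X Y)`, and otherwise `C_X α = 0`.
The function `L_X i_Y α ∈ Ω^0(M)` is read off by evaluation at `1 ∈ ⋀^0 T_pM`. -/
def HigherConnection.covDerivForm {n : ℕ} {M : Type*} [TopologicalSpace M]
    [ChartedSpace (EuclideanSpace ℝ (Fin n)) M] (C : HigherConnection n M) {k l m : ℕ}
    (X : KVField n M k) (α : DiffForm n M l) (Y : KVField n M m) (p : M) : ℝ :=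
  if 0 < k ∧ m + k = l + 1 then
    (-1 : ℝ) ^ (((k : ℤ) - 1) * ((l : ℤ) - 1)) * lieD X (interior Y.1 α.1) p 1
      - α.1 p ((C.toFun X Y).1 p)
  else 0

/-! ### Associative bilinear forms -/

/-- The set `ℬ(M)` of smooth associative bilinear forms on `⋀ TM`. -/
structure AssocForm (n : ℕ) (M : Type*) [TopologicalSpace M]
    [ChartedSpace (EuclideanSpace ℝ (Fin n)) M] where
  toFun : ∀ p : M, ExteriorAlgebra ℝ (TangentSpace (𝓡 n) p) →ₗ[ℝ]
    ExteriorAlgebra ℝ (TangentSpace (𝓡 n) p) →ₗ[ℝ] ℝ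
  assoc : ∀ (p : M) (k l m : ℕ), ∀ x ∈ ⋀[ℝ]^k (TangentSpace (𝓡 n) p),
    ∀ y ∈ ⋀[ℝ]^l (TangentSpace (𝓡 n) p), ∀ z ∈ ⋀[ℝ]^m (TangentSpace (𝓡 n) p),
      toFun p (x * y) z = toFun p x (y * z)
  smooth : ∀ k l : ℕ, ∀ X ∈ KVField n M k, ∀ Y ∈ KVField n M l,
    ContMDiff (𝓡 n) 𝓘(ℝ) ∞ (fun p ↦ toFun p (X.1 p) (Y.1 p))

/-- Taking the degree `t` component commutes with the maps induced on exterior algebras. -/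
theorem map_proj {V W : Type*} [AddCommGroup V] [Module ℝ V] [AddCommGroup W] [Module ℝ W]
    (f : V →ₗ[ℝ] W) (t : ℕ) (x : ExteriorAlgebra ℝ V) :
    ExteriorAlgebra.map f (GradedAlgebra.proj (fun i ↦ ⋀[ℝ]^i V) t x) =
      GradedAlgebra.proj (fun i ↦ ⋀[ℝ]^i W) t (ExteriorAlgebra.map f x) := by
  induction x using DirectSum.Decomposition.inductionOn (fun i ↦ ⋀[ℝ]^i V) with
  | zero => simp
  | add a b ha hb => simp only [map_add, ha, hb]
  | @homogeneous j a =>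
    have hfa : ExteriorAlgebra.map f (a : ExteriorAlgebra ℝ V) ∈ ⋀[ℝ]^j W := by
      have h : (⋀[ℝ]^j V).map (ExteriorAlgebra.map f).toLinearMap ≤ ⋀[ℝ]^j W := by
        rw [← ExteriorAlgebra.ιMulti_span_fixedDegree, Submodule.map_span_le]
        rintro _ ⟨v, rfl⟩
        simp only [AlgHom.toLinearMap_apply, ExteriorAlgebra.map_apply_ιMulti]
        rw [← ExteriorAlgebra.ιMulti_span_fixedDegree]
        exact Submodule.subset_span ⟨_, rfl⟩
      exact h ⟨_, a.2, rfl⟩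
    simp only [GradedAlgebra.proj_apply]
    by_cases hj : j = t
    · subst hj
      rw [DirectSum.decompose_of_mem_same (fun i ↦ ⋀[ℝ]^i V) a.2,
        DirectSum.decompose_of_mem_same (fun i ↦ ⋀[ℝ]^i W) hfa]
    · rw [DirectSum.decompose_of_mem_ne (fun i ↦ ⋀[ℝ]^i V) a.2 hj,
        DirectSum.decompose_of_mem_ne (fun i ↦ ⋀[ℝ]^i W) hfa hj, map_zero]

/-- The degree `t` component of a multivector field. -/
def component {n : ℕ} {M : Type*} [TopologicalSpace M]
    [ChartedSpace (EuclideanSpace ℝ (Fin n)) M] (t : ℕ) (X : MVField n M) : MVField n M :=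
  ⟨fun p ↦ GradedAlgebra.proj (fun i ↦ ⋀[ℝ]^i (TangentSpace (𝓡 n) p)) t (X.1 p), by
    intro p φ
    simp only [map_proj]
    exact X.2 p (φ ∘ₗ GradedAlgebra.proj (fun i ↦ ⋀[ℝ]^i (EuclideanSpace ℝ (Fin n))) t)⟩

/-- The `t`-form `η^{(t)}` associated with `η`, given by `η^{(t)}(x) = η(x, 1)` for
`x ∈ ⋀^t T_pM`. -/
def AssocForm.form {n : ℕ} {M : Type*} [TopologicalSpace M]
    [ChartedSpace (EuclideanSpace ℝ (Fin n)) M] (η : AssocForm n M) (t : ℕ) : DiffForm n M t :=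
  ⟨fun p ↦ (η.toFun p).flip 1 ∘ₗ
      GradedAlgebra.proj (fun i ↦ ⋀[ℝ]^i (TangentSpace (𝓡 n) p)) t, by
    refine ⟨fun j hj p x hx ↦ ?_, fun X ↦ ?_⟩
    · rw [LinearMap.comp_apply, GradedAlgebra.proj_apply,
        DirectSum.decompose_of_mem_ne (fun i ↦ ⋀[ℝ]^i (TangentSpace (𝓡 n) p)) hx hj, map_zero]
    · refine η.smooth t 0 (component t X) (fun p ↦ ?_) 1 (fun p ↦ ?_)
      · exact SetLike.coe_mem _
      · exact SetLike.GradedOne.one_mem⟩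

/-- The forms associated with `η` recover `η`: `η(x, y) = η^{(k+l)}(x ∧ y)` for `x ∈ ⋀^k T_pM` and
`y ∈ ⋀^l T_pM`. -/
theorem AssocForm.apply_eq_form {n : ℕ} {M : Type*} [TopologicalSpace M]
    [ChartedSpace (EuclideanSpace ℝ (Fin n)) M] (η : AssocForm n M) (p : M) (k l : ℕ)
    (x : ExteriorAlgebra ℝ (TangentSpace (𝓡 n) p)) (hx : x ∈ ⋀[ℝ]^k (TangentSpace (𝓡 n) p))
    (y : ExteriorAlgebra ℝ (TangentSpace (𝓡 n) p)) (hy : y ∈ ⋀[ℝ]^l (TangentSpace (𝓡 n) p)) :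
    η.toFun p x y = (η.form (k + l)).1 p (x * y) := by
  have h : x * y ∈ ⋀[ℝ]^(k + l) (TangentSpace (𝓡 n) p) :=
    SetLike.GradedMul.mul_mem (A := fun i ↦ ⋀[ℝ]^i (TangentSpace (𝓡 n) p)) hx hy
  change _ = η.toFun p (GradedAlgebra.proj (fun i ↦ ⋀[ℝ]^i (TangentSpace (𝓡 n) p)) (k + l) (x * y)) 1
  rw [GradedAlgebra.proj_apply, DirectSum.decompose_of_mem_same
    (fun i ↦ ⋀[ℝ]^i (TangentSpace (𝓡 n) p)) h,
    η.assoc p k l 0 x hx y hy 1 (SetLike.GradedOne.one_mem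
      (A := fun i ↦ ⋀[ℝ]^i (TangentSpace (𝓡 n) p))), mul_one]

/-- The exterior product `A^k(M) × A^l(M) → A^{k+l}(M)`. -/
def wedge {n : ℕ} {M : Type*} [TopologicalSpace M]
    [ChartedSpace (EuclideanSpace ℝ (Fin n)) M] {k l : ℕ}
    (X : KVField n M k) (Y : KVField n M l) : KVField n M (k + l) :=
  ⟨X.1 * Y.1, fun p ↦ SetLike.GradedMul.mul_mem
    (A := fun i ↦ ⋀[ℝ]^i (TangentSpace (𝓡 n) p)) (X.2 p) (Y.2 p)⟩

/-- The function `(C_X η)(Y, Z) = (C_X η^{(t)})(Y ∧ Z)`, where `t = k + l + m - 1`, for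
`X ∈ A^k(M)`, `Y ∈ A^l(M)`, `Z ∈ A^m(M)`. -/
def HigherConnection.covDerivAssoc {n : ℕ} {M : Type*} [TopologicalSpace M]
    [ChartedSpace (EuclideanSpace ℝ (Fin n)) M] (C : HigherConnection n M) (η : AssocForm n M)
    {k l m : ℕ} (X : KVField n M k) (Y : KVField n M l) (Z : KVField n M m) (p : M) : ℝ :=
  C.covDerivForm X (η.form (k + l + m - 1)) (wedge Y Z) p

/-- `C η ≡ 0`: the form `η` is parallel with respect to `C`. -/
def HigherConnection.IsParallel {n : ℕ} {M : Type*} [TopologicalSpace M]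
    [ChartedSpace (EuclideanSpace ℝ (Fin n)) M] (C : HigherConnection n M)
    (η : AssocForm n M) : Prop :=
  ∀ k l m : ℕ, 0 < k → 0 < l + m → k + l + m ≤ n + 1 →
    ∀ (X : KVField n M k) (Y : KVField n M l) (Z : KVField n M m) (p : M),
      C.covDerivAssoc η X Y Z p = 0

end HigherConnections

end

namespace HigherConnections

/-! In $(\nabla_X\omega)(Y)=\pm L_Xi_Y\omega-\omega(\nabla_XY)$ the connection enters only through
the last term, and linearly. Since $\nabla_XY=\widetilde\nabla_XY+F^{k,l}(X,Y)$, the Lie derivative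
terms of $\nabla$ and $\widetilde\nabla$ coincide and
$(\nabla_X\omega)(Y)=(\widetilde\nabla_X\omega)(Y)-\omega(F^{k,l}(X,Y))$. This is
`HigherConnection.HasData.covDerivForm_eq`. By it, the twist equation for $(X,Y)$ says exactly that
$(\nabla_X\omega^{(t)})(Y)=0$.

It remains to match the two families of test fields. Parallelism tests $\nabla_X\omega^{(t)}$ on
products $Y\wedge Z$ of positive total degree, the twist equation on single fields of positive
degree. These are the same fields: each $Y$ equals $Y\wedge1$, and each $Y\wedge Z$ is a single
field of degree $l+m$. -/

/-- The covariant derivatives of a form along `C` and along the induced connection of its data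
differ by the twist fields. -/
theorem HigherConnection.HasData.covDerivForm_eq {n : ℕ} {M : Type*} [TopologicalSpace M]
    [ChartedSpace (EuclideanSpace ℝ (Fin n)) M] [IsManifold (𝓡 n) ∞ M]
    {C : HigherConnection n M}
    {D : CovariantDerivative (𝓡 n) (EuclideanSpace ℝ (Fin n)) (fun p : M ↦ TangentSpace (𝓡 n) p)}
    {Dt : HigherConnection n M} {F : TwistFields n M} (h : C.HasData D Dt F) {k t l : ℕ}
    (hk : 0 < k) (ht : l + k = t + 1) (X : KVField n M k) (α : DiffForm n M t)
    (Y : KVField n M l) (p : M) :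
    C.covDerivForm X α Y p = Dt.covDerivForm X α Y p - α.1 p ((F.app X Y).1 p) := by
  have hF : (C.toFun X Y).1 p = (Dt.toFun X Y).1 p + (F.app X Y).1 p := by
    rw [h.2.2 k l X Y]
    rfl
  -- `hk` and `ht` select the branch of the `if` that carries the formula, for both connections; the
  -- Lie derivative terms then cancel in `ring`.
  simp only [HigherConnection.covDerivForm, hk, ht, and_self, if_true, hF, map_add]
  ring

end HigherConnections

theorem mainTheorem11 (n : ℕ) (M : Type*) [TopologicalSpace M] [T2Space M]
    [SecondCountableTopology M] [ChartedSpace (EuclideanSpace ℝ (Fin n)) M]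
    [IsManifold (𝓡 n) ∞ M]
    (η : HigherConnections.AssocForm n M)
    (nabla : HigherConnections.HigherConnection n M)
    (D : CovariantDerivative (𝓡 n) (EuclideanSpace ℝ (Fin n))
      (fun p : M ↦ TangentSpace (𝓡 n) p))
    (Dt : HigherConnections.HigherConnection n M)
    (F : HigherConnections.TwistFields n M)
    (hdata : nabla.HasData D Dt F) :
    nabla.IsParallel η ↔
      ∀ k l : ℕ, 0 < k → 0 < l → k + l - 1 ≤ n →
        ∀ (X : HigherConnections.KVField n M k) (Y : HigherConnections.KVField n M l) (p : M),
          Dt.covDerivForm X (η.form (k + l - 1)) Y p =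
            (η.form (k + l - 1)).1 p ((F.app X Y).1 p) := by
  constructor
  · intro h k l hk hl hkl X Y p
    -- The constant function 1 serves as the second test field, of degree $m=0$, so that
    -- $Y\wedge1=Y$.
    let one : HigherConnections.KVField n M 0 :=
      ⟨1, fun q ↦ SetLike.GradedOne.one_mem (A := fun i ↦ ⋀[ℝ]^i (TangentSpace (𝓡 n) q))⟩
    -- The equation typechecks because `l + 0` reduces to `l`.
    have hY : HigherConnections.wedge Y one = Y := Subtype.ext (mul_one Y.1)
    have key : nabla.covDerivForm X (η.form (k + l - 1)) (HigherConnections.wedge Y one) p = 0 :=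
      -- The condition $l+m>0$ becomes $l>0$, and $k+l-1\le n$ gives the bound $k+l+0\le n+1$.
      h k l 0 hk (by omega) (by omega) X Y one p
    rw [hY, hdata.covDerivForm_eq hk (by omega)] at key
    exact sub_eq_zero.mp key
  · intro h k l m hk hlm hle X Y Z p
    rw [HigherConnections.HigherConnection.covDerivAssoc, hdata.covDerivForm_eq hk (by omega),
      -- Reassociating the degree to $k+(l+m)-1$ makes the goal the twist equation for $X$ and the
      -- single field $Y\wedge Z$; its positivity condition is `hlm`.
      sub_eq_zero, Nat.add_assoc k l m]
    exact h k (l + m) hk hlm (by omega) X (HigherConnections.wedge Y Z) p
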